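/- A dcpo is a partially ordered set in which every nonempty directed subset has a supremum; $\mathbf{DCPO}$ is the category of dcpos and Scott-continuous maps, with its cartesian products. For a dcpo $D$ let $\sigma D$ be its lattice of Scott-open sets. A subprobability valuation on $D$ is a Scott-continuous map $\nu\colon\sigma D\to[0,1]$ with $\nu(\emptyset)=0$ and $\nu(U)+\nu(V)=\nu(U\cup V)+\nu(U\cap V)$ for all $U,V\in\sigma D$; these form a dcpo $\mathcal V D$ under the order $\nu_1\le\nu_2\iff\nu_1(U)\le\nu_2(U)$ for all $U\in\sigma D$. For Scott-continuous $h\colon D\to[0,1]$ put $\int h\,d\nu=\int_0^1\nu(h^{-1}(t,1])\,dt$. Call $\nu\in\mathcal V D$ central if for every dcpo $E$, every $\mu\in\mathcal V E$ and every Scott-continuous $h\colon D\times E\to[0,1]$ $$\int_{x\in D}\int_{y\in E}h(x,y)\,d\mu\,d\nu=\int_{y\in E}\int_{x\in D}h(x,y)\,d\nu\,d\mu,$$ and let $\mathcal Z D\subseteq\mathcal V D$ be the set of central valuations on $D$. Theorem. For every dcpo $D$, $\mathcal Z D$ is closed under directed suprema in $\mathcal V D$, hence a dcpo in the induced order. The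 assignment $\mathcal V$ is a strong monad on $\mathbf{DCPO}$ with unit $x\mapsto\delta_x$ (where $\delta_x(U)=1$ if $x\in U$ and $\delta_x(U)=0$ otherwise), Kleisli extension $f^\dagger(\nu)(U)=\int_{x\in D} f(x)(U)\,d\nu$ for Scott-continuous $f\colon D\to\mathcal V E$, and strength $D\times\mathcal V E\to\mathcal V(D\times E)$, $(x,\nu)\mapsto\big(U\mapsto\nu(\{y\in E\mid(x,y)\in U\})\big)$. The unit, the Kleisli extension (for Scott-continuous $f\colon D\to\mathcal Z E\subseteq\mathcal V E$) and the strength of $\mathcal V$ (co)restrict to $\mathcal Z$, and with the (co)restricted operations $\mathcal Z$ is a strong monad on $\mathbf{DCPO}$ that is commutative, i.e. for all dcpos $D,E$ the two canonical maps $\mathcal Z D\times\mathcal Z E\to\mathcal Z(D\times E)$ induced by the strength coincide. In other words, $\mathcal Z$ is a commutative submonad of $\mathcal V$. -/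

import Mathlib

open CategoryTheory MonoidalCategory

universe u v w

/-! ### Dcpos and the category DCPO -/

/-- A partial order is a dcpo if every (nonempty) directed subset has a least upper bound.
No least element is required. -/
class IsDcpo (α : Type*) [PartialOrder α] : Prop where
  exists_isLUB : ∀ ⦃d : Set α⦄, d.Nonempty → DirectedOn (· ≤ ·) d → ∃ a, IsLUB d a

instance IsDcpo.prod {α β : Type*} [PartialOrder α] [PartialOrder β] [IsDcpo α] [IsDcpo β] :
    IsDcpo (α × β) where
  exists_isLUB d hne hd := by
    obtain ⟨a, ha⟩ := IsDcpo.exists_isLUB (hne.image Prod.fst) hd.fst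
    obtain ⟨b, hb⟩ := IsDcpo.exists_isLUB (hne.image Prod.snd) hd.snd
    exact ⟨(a, b), isLUB_prod.2 ⟨ha, hb⟩⟩

instance IsDcpo.punit : IsDcpo PUnit.{u + 1} where
  exists_isLUB _ _ _ := ⟨PUnit.unit, fun _ _ => le_rfl, fun _ _ => le_rfl⟩

/-- A bundled dcpo: an object of the category `DCPO`. -/
structure DCPO : Type (u + 1) where
  /-- The underlying set. -/
  carrier : Type u
  [order : PartialOrder carrier]
  [isDcpo : IsDcpo carrier]

/-- A Scott-continuous map, bundled. -/
structure ScottHom (α : Type v) (β : Type w) [PartialOrder α] [PartialOrder β] where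
  /-- The underlying function. -/
  toFun : α → β
  /-- It preserves suprema of directed sets. -/
  scottContinuous : ScottContinuous toFun

namespace ScottHom

variable {α : Type v} {β : Type w} [PartialOrder α] [PartialOrder β]

instance : FunLike (ScottHom α β) α β where
  coe := toFun
  coe_injective := by
    rintro ⟨f, _⟩ ⟨g, _⟩ h
    congr

end ScottHom

namespace DCPO

instance : CoeSort DCPO.{u} (Type u) := ⟨DCPO.carrier⟩

attribute [instance] DCPO.order DCPO.isDcpo

/-- The dcpo with a given underlying partial order. -/
abbrev of (α : Type u) [PartialOrder α] [IsDcpo α] : DCPO.{u} := ⟨α⟩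

/-- The category of dcpos and Scott-continuous maps. -/
instance : Category DCPO.{u} where
  Hom D E := ScottHom D E
  id _ := ⟨fun x => x, ScottContinuous.id⟩
  comp f g := ⟨fun x => g.toFun (f.toFun x), ScottContinuous.comp f.scottContinuous g.scottContinuous⟩

instance : ConcreteCategory DCPO.{u} (fun D E => ScottHom D E) where
  hom f := f
  ofHom f := f

@[ext]
theorem hom_ext {D E : DCPO.{u}} {f g : D ⟶ E} (h : ∀ x : D, f x = g x) : f = g :=
  ConcreteCategory.hom_ext _ _ h

/-- The one-point dcpo, as a terminal object. -/
def terminalCone : Limits.LimitCone (Functor.empty.{0} DCPO.{u}) where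
  cone := Limits.asEmptyCone (DCPO.of PUnit.{u + 1})
  isLimit := Limits.IsTerminal.ofUniqueHom
    (fun _ => (⟨fun _ => PUnit.unit, ScottContinuous.const _⟩ : ScottHom _ _))
    (fun _ _ => hom_ext fun _ => rfl)

/-- The product of two dcpos, with the componentwise order, as a categorical product. -/
def prodCone (D E : DCPO.{u}) : Limits.LimitCone (Limits.pair D E) where
  cone := Limits.BinaryFan.mk (P := DCPO.of (D × E))
    (⟨Prod.fst, ScottContinuous.fst⟩ : ScottHom _ _)
    (⟨Prod.snd, ScottContinuous.snd⟩ : ScottHom _ _)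
  isLimit := Limits.BinaryFan.IsLimit.mk _
    (fun f g => (⟨fun x => (f x, g x), f.scottContinuous.prodMk g.scottContinuous⟩ :
      ScottHom _ _))
    (fun _ _ => rfl) (fun _ _ => rfl)
    (fun _ _ _ h₁ h₂ => hom_ext fun x => Prod.ext
      (congrArg (fun k => k x) h₁) (congrArg (fun k => k x) h₂))

/-- `DCPO` as a cartesian monoidal category: `D ⊗ E` is the product dcpo `D × E`. -/
instance : CartesianMonoidalCategory DCPO.{u} :=
  .ofChosenFiniteProducts terminalCone prodCone

instance : BraidedCategory DCPO.{u} := .ofCartesianMonoidalCategory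

/-- A sub-dcpo of `D`: a subset closed under suprema of directed sets, with the induced order. -/
def sub (D : DCPO.{u}) (S : Set D) (hS : DirSupClosed S) : DCPO.{u} where
  carrier := S
  isDcpo := ⟨fun d hne hd => by
    obtain ⟨a, ha⟩ := IsDcpo.exists_isLUB (hne.image Subtype.val)
      (hd.mono_comp (fun _ _ h => h) : DirectedOn (· ≤ ·) (Subtype.val '' d))
    have haS : a ∈ S := hS (by rintro _ ⟨x, _, rfl⟩; exact x.2) (hne.image _)
      (hd.mono_comp (fun _ _ h => h)) ha
    exact ⟨⟨a, haS⟩, fun x hx => ha.1 ⟨x, hx, rfl⟩,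
      fun b hb => ha.2 (by rintro _ ⟨x, hx, rfl⟩; exact hb hx)⟩⟩

/-- The inclusion of a sub-dcpo. -/
def subIncl (D : DCPO.{u}) (S : Set D) (hS : DirSupClosed S) : D.sub S hS ⟶ D :=
  (⟨Subtype.val, fun d hne hd a ha => by
    have hd' : DirectedOn (· ≤ ·) (Subtype.val '' d) := hd.mono_comp (fun _ _ h => h)
    obtain ⟨b, hb⟩ := IsDcpo.exists_isLUB (hne.image Subtype.val) hd'
    have hbS : b ∈ S := hS (by rintro _ ⟨x, _, rfl⟩; exact x.2) (hne.image _) hd' hb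
    have hab : a = ⟨b, hbS⟩ := ha.unique
      ⟨fun x hx => hb.1 ⟨x, hx, rfl⟩, fun c hc => hb.2 (by rintro _ ⟨x, hx, rfl⟩; exact hc hx)⟩
    rw [hab]
    exact hb⟩ : ScottHom S D)

end DCPO

/-! ### Scott-open sets -/

/-- The set `σ D` of Scott-open subsets of `D`, ordered by inclusion. -/
abbrev ScottOpens (D : Type*) [PartialOrder D] : Type _ :=
  TopologicalSpace.Opens (Topology.WithScott D)

namespace ScottOpens

variable {D E : Type*} [PartialOrder D] [PartialOrder E]

/-- The largest Scott-open subset contained in `A`; it is `A` itself if `A` is Scott-open. -/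
def interior (A : Set D) : ScottOpens D :=
  TopologicalSpace.Opens.interior (Topology.WithScott.ofScott ⁻¹' A)

/-- The inverse image of a Scott-open set under a Scott-continuous map. -/
def preimage (f : D → E) (hf : ScottContinuous f) (U : ScottOpens E) : ScottOpens D :=
  TopologicalSpace.Opens.comap
    ⟨fun x : Topology.WithScott D =>
        Topology.WithScott.toScott (f (Topology.WithScott.ofScott x)),
      (Topology.IsScott.scottContinuousOn_iff_continuous (α := Topology.WithScott D)
        (β := Topology.WithScott E) (D := Set.univ)
        (fun _ _ _ => Set.mem_univ _)).1 (scottContinuousOn_univ.2 hf)⟩ U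

end ScottOpens

/-! ### Subprobability valuations -/

/-- A subprobability valuation on `D`: a strict, modular, Scott-continuous map from the
Scott-open subsets of `D` to `[0, 1]`. -/
@[ext]
structure SubprobValuation (D : Type u) [PartialOrder D] where
  /-- The value on a Scott-open set. -/
  toFun : ScottOpens D → unitInterval
  scottContinuous : ScottContinuous toFun
  strict : toFun ⊥ = 0
  modular : ∀ U V : ScottOpens D,
    (toFun U : ℝ) + toFun V = toFun (U ⊔ V) + toFun (U ⊓ V)

namespace SubprobValuation

variable {D : Type u} [PartialOrder D]

instance : CoeFun (SubprobValuation D) (fun _ => ScottOpens D → unitInterval) := ⟨toFun⟩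

/-- The stochastic order: `ν₁ ≤ ν₂` iff `ν₁ U ≤ ν₂ U` for every Scott-open set `U`. -/
instance : PartialOrder (SubprobValuation D) :=
  PartialOrder.lift toFun fun _ _ h => SubprobValuation.ext h

/-- The valuations form a dcpo in the stochastic order (suprema are computed pointwise). -/
instance : IsDcpo (SubprobValuation D) where
  exists_isLUB d hne hd := by
    let F : ScottOpens D → unitInterval := fun U => sSup ((fun ν : SubprobValuation D => ν U) '' d)
    have hF : ∀ U, IsLUB ((fun ν : SubprobValuation D => ν U) '' d) (F U) :=
      fun U => isLUB_sSup _
    have le_F : ∀ ν ∈ d, ∀ U, ν U ≤ F U := fun ν hν U => (hF U).1 ⟨ν, hν, rfl⟩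
    have F_le : ∀ U (c : ℝ), (∀ ν ∈ d, (ν U : ℝ) ≤ c) → (F U : ℝ) ≤ c := by
      intro U c hc
      obtain ⟨ν₀, hν₀⟩ := hne
      have h0 : 0 ≤ c := (ν₀ U).2.1.trans (hc ν₀ hν₀)
      rcases le_total 1 c with h1 | h1
      · exact (F U).2.2.trans h1
      · have : F U ≤ (⟨c, h0, h1⟩ : unitInterval) :=
          (hF U).2 (by rintro _ ⟨ν, hν, rfl⟩; exact hc ν hν)
        exact this
    have mono : ∀ (ν : SubprobValuation D) {U V}, U ≤ V → ν U ≤ ν V :=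
      fun ν _ _ h => ν.scottContinuous.monotone h
    have key : ∀ (U V : ScottOpens D) (c : ℝ), (∀ ν ∈ d, (ν U : ℝ) + ν V ≤ c) →
        (F U : ℝ) + F V ≤ c := by
      intro U V c h
      have h1 : ∀ ν₂ ∈ d, (F U : ℝ) ≤ c - ν₂ V := fun ν₂ h₂ => F_le U _ fun ν₁ h₁ => by
        obtain ⟨ν, hν, h₁', h₂'⟩ := hd ν₁ h₁ ν₂ h₂
        have a1 : (ν₁ U : ℝ) ≤ ν U := h₁' U
        have a2 : (ν₂ V : ℝ) ≤ ν V := h₂' V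
        linarith [h ν hν]
      have h2 : (F V : ℝ) ≤ c - F U := F_le V _ fun ν₂ h₂ => by linarith [h1 ν₂ h₂]
      linarith
    refine ⟨⟨F, ?_, ?_, ?_⟩, fun ν hν U => le_F ν hν U, fun ν hν U => (hF U).2 ?_⟩
    · intro c hc hcd U hU
      refine ⟨?_, fun b hb => (hF U).2 ?_⟩
      · rintro _ ⟨V, hV, rfl⟩
        refine (hF V).2 ?_
        rintro _ ⟨ν, hν, rfl⟩
        exact (mono ν (hU.1 hV)).trans (le_F ν hν U)
      · rintro _ ⟨ν, hν, rfl⟩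
        refine (ν.scottContinuous hc hcd hU).2 ?_
        rintro _ ⟨V, hV, rfl⟩
        exact (le_F ν hν V).trans (hb ⟨V, hV, rfl⟩)
    · refine le_antisymm ((hF ⊥).2 ?_) bot_le
      rintro _ ⟨ν, _, rfl⟩
      exact ν.strict.le
    · intro U V
      refine le_antisymm (key _ _ _ fun ν hν => ?_) (key _ _ _ fun ν hν => ?_)
      · have a1 : (ν (U ⊔ V) : ℝ) ≤ F (U ⊔ V) := le_F ν hν _
        have a2 : (ν (U ⊓ V) : ℝ) ≤ F (U ⊓ V) := le_F ν hν _
        linarith [ν.modular U V]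
      · have a1 : (ν U : ℝ) ≤ F U := le_F ν hν _
        have a2 : (ν V : ℝ) ≤ F V := le_F ν hν _
        linarith [ν.modular U V]
    · rintro _ ⟨μ, hμ, rfl⟩
      exact hν hμ U

/-- The integral `∫ h dν = ∫₀¹ ν {x | h x > t} dt` of a Scott-continuous map `h : D → [0, 1]`.
It is only used for such `h`; the sets `{x | h x > t}` are then Scott-open, so that taking their
interior does not change them. -/
noncomputable def integral (ν : SubprobValuation D) (h : D → ℝ) : ℝ :=
  ∫ t in (0 : ℝ)..1, (ν (ScottOpens.interior {x | t < h x}) : ℝ)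

/-- A subprobability valuation `ν` on a dcpo `D` is central if integration against `ν` commutes
with integration against every valuation `μ` on every dcpo `E`, for all Scott-continuous
`h : D × E → [0, 1]`. -/
def IsCentral (ν : SubprobValuation D) : Prop :=
  ∀ (E : DCPO.{u}) (μ : SubprobValuation E) (h : D × E → unitInterval), ScottContinuous h →
    ν.integral (fun x => μ.integral fun y => h (x, y)) =
      μ.integral (fun y => ν.integral fun x => h (x, y))

end SubprobValuation

namespace DCPO

/-- The dcpo `𝒱 D` of subprobability valuations on `D`, in the stochastic order. -/
def V (D : DCPO.{u}) : DCPO.{u} := DCPO.of (SubprobValuation D)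

/-- The set of central valuations on `D`, as a subset of `𝒱 D`. -/
def centralSet (D : DCPO.{u}) : Set D.V :=
  {ν : SubprobValuation D | ν.IsCentral}

/-- The dcpo `𝒵 D` of central valuations on `D`, as a sub-dcpo of `𝒱 D`. -/
def Z (hZ : ∀ D : DCPO.{u}, DirSupClosed D.centralSet) (D : DCPO.{u}) : DCPO.{u} :=
  D.V.sub D.centralSet (hZ D)

/-- The inclusion of `𝒵 D` into `𝒱 D`. -/
def inclZ (hZ : ∀ D : DCPO.{u}, DirSupClosed D.centralSet) (D : DCPO.{u}) : Z hZ D ⟶ D.V :=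
  D.V.subIncl D.centralSet (hZ D)

/-- The value `ν U` of an element `ν` of `𝒱 D` on a Scott-open set `U`. -/
def V.eval {D : DCPO.{u}} (ν : D.V) (U : ScottOpens D) : unitInterval :=
  SubprobValuation.toFun (D := D) ν U

/-- The element `(x, y)` of the product dcpo. -/
def pair {D E : DCPO.{u}} (x : D) (y : E) : (D ⊗ E : DCPO.{u}) :=
  ((x, y) : D × E)

/-- For `U` Scott-open in `D × E` and `x` in `D`, the Scott-open set `{y | (x, y) ∈ U}`. -/
def slice {D E : DCPO.{u}} (x : D) (U : ScottOpens (D ⊗ E : DCPO.{u})) : ScottOpens E :=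
  ScottOpens.preimage (fun y : E => pair x y)
    ((ScottContinuous.const x).prodMk ScottContinuous.id) U

end DCPO

/-! ### Strong and commutative monads -/

/-- A monad on `C` with action `T` on objects, presented as a Kleisli triple: a unit and a
Kleisli extension satisfying the three laws. -/
structure KleisliTriple {C : Type u} [Category.{v} C] (T : C → C) where
  /-- The unit. -/
  unit : ∀ X : C, X ⟶ T X
  /-- The Kleisli extension `f ↦ f†`. -/
  ext : ∀ {X Y : C}, (X ⟶ T Y) → (T X ⟶ T Y)
  ext_unit : ∀ X : C, ext (unit X) = 𝟙 (T X)
  unit_ext : ∀ {X Y : C} (f : X ⟶ T Y), unit X ≫ ext f = f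
  ext_ext : ∀ {X Y Z : C} (f : X ⟶ T Y) (g : Y ⟶ T Z), ext f ≫ ext g = ext (f ≫ ext g)

/-- The monad of a Kleisli triple: `T f = (f ≫ unit)†`, with multiplication `(𝟙)†`. -/
def KleisliTriple.toMonad {C : Type u} [Category.{v} C] {T : C → C} (K : KleisliTriple T) :
    Monad C where
  obj := T
  map f := K.ext (f ≫ K.unit _)
  map_id X := by rw [Category.id_comp, K.ext_unit]
  map_comp f g := by rw [K.ext_ext, Category.assoc, Category.assoc, K.unit_ext]
  η := { app := K.unit, naturality := fun _ _ f => (K.unit_ext (f ≫ K.unit _)).symm }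
  μ :=
    { app := fun X => K.ext (𝟙 (T X))
      naturality := fun X Y f => by
        change K.ext (K.ext (f ≫ K.unit _) ≫ K.unit _) ≫ K.ext (𝟙 _) =
          K.ext (𝟙 _) ≫ K.ext (f ≫ K.unit _)
        rw [K.ext_ext, K.ext_ext, Category.assoc, K.unit_ext, Category.comp_id,
          Category.id_comp] }
  assoc X := by
    change K.ext (K.ext (𝟙 _) ≫ K.unit _) ≫ K.ext (𝟙 _) = K.ext (𝟙 _) ≫ K.ext (𝟙 _)
    rw [K.ext_ext, K.ext_ext, Category.assoc, K.unit_ext, Category.comp_id, Category.id_comp]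
  left_unit X := K.unit_ext (𝟙 _)
  right_unit X := by
    change K.ext (K.unit _ ≫ K.unit _) ≫ K.ext (𝟙 _) = 𝟙 _
    rw [K.ext_ext, Category.assoc, K.unit_ext, Category.comp_id, K.ext_unit]

/-- A (tensorial) strength for a monad `T` on a monoidal category. -/
structure MonadStrength {C : Type u} [Category.{v} C] [MonoidalCategory C] (T : Monad C) where
  /-- The strength. -/
  str : ∀ X Y : C, X ⊗ T.obj Y ⟶ T.obj (X ⊗ Y)
  naturality : ∀ {X X' Y Y' : C} (f : X ⟶ X') (g : Y ⟶ Y'),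
    (f ⊗ₘ T.map g) ≫ str X' Y' = str X Y ≫ T.map (f ⊗ₘ g)
  leftUnitor : ∀ Y : C, str (𝟙_ C) Y ≫ T.map (λ_ Y).hom = (λ_ (T.obj Y)).hom
  associator : ∀ X Y Z : C,
    str (X ⊗ Y) Z ≫ T.map (α_ X Y Z).hom =
      (α_ X Y (T.obj Z)).hom ≫ X ◁ str Y Z ≫ str X (Y ⊗ Z)
  unit : ∀ X Y : C, X ◁ T.η.app Y ≫ str X Y = T.η.app (X ⊗ Y)
  mult : ∀ X Y : C,
    X ◁ T.μ.app Y ≫ str X Y = str X (T.obj Y) ≫ T.map (str X Y) ≫ T.μ.app (X ⊗ Y)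

namespace MonadStrength

variable {C : Type u} [Category.{v} C] [MonoidalCategory C] [BraidedCategory C] {T : Monad C}

/-- The costrength obtained from the strength by conjugating with the braiding. -/
def costr (t : MonadStrength T) (X Y : C) : T.obj X ⊗ Y ⟶ T.obj (X ⊗ Y) :=
  (β_ (T.obj X) Y).hom ≫ t.str Y X ≫ T.map (β_ Y X).hom

/-- A strong monad is commutative if the two canonical maps `T X ⊗ T Y ⟶ T (X ⊗ Y)` agree. -/
def IsCommutative (t : MonadStrength T) : Prop :=
  ∀ X Y : C,
    t.costr X (T.obj Y) ≫ T.map (t.str X Y) ≫ T.μ.app (X ⊗ Y) =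
      t.str (T.obj X) Y ≫ T.map (t.costr X Y) ≫ T.μ.app (X ⊗ Y)

end MonadStrength

/-! ### Scott-continuous real functions and their superlevel sets -/

/-! Centrality is an interchange identity for iterated integrals, so everything rests on calculus
for `integral`. The tool is the lower Riemann sum of mesh `1 / n`. It lies within `1 / n` of the
integral, uniformly in the valuation and the integrand, and it is a finite average of values `ν U`.
A property that holds for evaluations and survives finite averages therefore passes to integrals.
This gives joint Scott continuity in valuation and integrand (`scottContinuous_integral`),
additivity (`card_mul_integral_average`, resting on modularity through `sum_apply_superlevel_count`)
and integration against a Kleisli extension (`integral_bind`).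

The monad laws for `𝒱` are then identities between integrals. Centrality holds for Dirac valuations,
where both iterated integrals are evaluations. It passes to `bind` by swapping twice, and to
directed suprema because both iterated integrals are Scott-continuous in `ν`. The strength is itself
a `bind` of Dirac valuations, so it preserves centrality as well.

The laws for `𝒵` follow by cancelling its monic inclusion into `𝒱`. The two double strengths at `(ν,
μ)` send an open `U` to the two iterated integrals of the indicator of `U`, and these agree as soon
as `ν` is central. -/

theorem isLUB_coe_unitInterval {d : Set unitInterval} (hd : d.Nonempty) {a : unitInterval}
    (ha : IsLUB d a) : IsLUB ((↑) '' d : Set ℝ) (a : ℝ) := by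
  refine ⟨?_, fun b hb => ?_⟩
  · rintro _ ⟨x, hx, rfl⟩
    exact ha.1 hx
  · obtain ⟨x₀, hx₀⟩ := hd
    -- Nonemptiness enters here: without it a real upper bound could be negative.
    have h0 : 0 ≤ b := x₀.2.1.trans (hb ⟨x₀, hx₀, rfl⟩)
    rcases le_total 1 b with h1 | h1
    · exact a.2.2.trans h1
    · have : a ≤ (⟨b, h0, h1⟩ : unitInterval) := ha.2 fun x hx => hb ⟨x, hx, rfl⟩
      exact this

theorem scottContinuous_coe_unitInterval : ScottContinuous ((↑) : unitInterval → ℝ) :=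
  fun _ hne _ _ ha => isLUB_coe_unitInterval hne ha

theorem ScottContinuous.of_coe_unitInterval {A : Type*} [Preorder A] {f : A → unitInterval}
    (hf : ScottContinuous fun a => (f a : ℝ)) : ScottContinuous f := by
  intro d hne hd a ha
  have h := hf hne hd ha
  refine ⟨?_, fun b hb => ?_⟩
  · rintro _ ⟨x, hx, rfl⟩
    exact h.1 ⟨x, hx, rfl⟩
  · refine h.2 ?_
    rintro _ ⟨x, hx, rfl⟩
    exact hb ⟨x, hx, rfl⟩

namespace ScottOpens

variable {D : Type*} [PartialOrder D]

theorem ext_mem {U V : ScottOpens D}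
    (h : ∀ x : D, Topology.WithScott.toScott x ∈ U ↔ Topology.WithScott.toScott x ∈ V) : U = V :=
  TopologicalSpace.Opens.ext (Set.ext h)

theorem interior_mono {A B : Set D} (h : A ⊆ B) : interior A ≤ interior B :=
  _root_.interior_mono (Set.preimage_mono h)

theorem isOpen_iff {A : Set D} :
    IsOpen (Topology.WithScott.ofScott ⁻¹' A) ↔ IsUpperSet A ∧ DirSupInacc A := by
  rw [Topology.IsScott.isOpen_iff_isUpperSet_and_dirSupInaccOn (D := Set.univ),
    dirSupInaccOn_univ]
  rfl

theorem mem_interior_of_isOpen {A : Set D} (hA : IsUpperSet A ∧ DirSupInacc A) {x : D} :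
    Topology.WithScott.toScott x ∈ interior A ↔ x ∈ A := by
  have h : IsOpen (Topology.WithScott.ofScott ⁻¹' A) := isOpen_iff.2 hA
  change Topology.WithScott.toScott x ∈ _root_.interior (Topology.WithScott.ofScott ⁻¹' A) ↔ _
  rw [h.interior_eq]
  rfl

theorem isUpperSet_and_dirSupInacc (U : ScottOpens D) :
    IsUpperSet {x : D | Topology.WithScott.toScott x ∈ U} ∧
      DirSupInacc {x : D | Topology.WithScott.toScott x ∈ U} :=
  isOpen_iff.1 U.isOpen

theorem mem_interior_lt {h : D → ℝ} (hh : ScottContinuous h) (t : ℝ) {x : D} :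
    Topology.WithScott.toScott x ∈ interior {x | t < h x} ↔ t < h x := by
  refine mem_interior_of_isOpen ⟨fun a b hab ha => lt_of_lt_of_le ha (hh.monotone hab),
    fun d hne hd a ha hta => ?_⟩
  obtain ⟨_, ⟨x, hx, rfl⟩, htx⟩ := (lt_isLUB_iff (hh hne hd ha)).1 hta
  exact ⟨x, hx, htx⟩

/-- Because the inequality is strict, a directed supremum of values exceeds `t` only if one of the
values does; so the superlevel set of the supremum is the union of the superlevel sets. -/
theorem scottContinuous_superlevel {A : Type*} [PartialOrder A] {h : A × D → ℝ}
    (hh : ScottContinuous h) (t : ℝ) :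
    ScottContinuous fun a => interior {x | t < h (a, x)} := by
  have hx : ∀ a, ScottContinuous fun x => h (a, x) := fun a =>
    ((ScottContinuous.const a).prodMk ScottContinuous.id).comp hh
  have ha : ∀ x, ScottContinuous fun a => h (a, x) := fun x =>
    (ScottContinuous.id.prodMk (ScottContinuous.const x)).comp hh
  intro d hne hd a had
  refine ⟨?_, fun V hV => ?_⟩
  · rintro _ ⟨b, hb, rfl⟩
    exact interior_mono fun x hx => lt_of_lt_of_le hx ((ha x).monotone (had.1 hb))
  · intro x hxm
    obtain ⟨_, ⟨b, hb, rfl⟩, htb⟩ :=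
      (lt_isLUB_iff (ha x hne hd had)).1 ((mem_interior_lt (hx a) t (x := x)).1 hxm)
    exact hV ⟨b, hb, rfl⟩ ((mem_interior_lt (hx b) t (x := x)).2 htb)

/-! ### Indicator functions of Scott-open sets -/

open Classical in
/-- The indicator function of a Scott-open set. -/
noncomputable def indicator (U : ScottOpens D) (x : D) : ℝ :=
  if Topology.WithScott.toScott x ∈ U then 1 else 0

theorem indicator_nonneg (U : ScottOpens D) (x : D) : 0 ≤ U.indicator x := by
  unfold indicator; split_ifs <;> norm_num

theorem indicator_le_one (U : ScottOpens D) (x : D) : U.indicator x ≤ 1 := by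
  unfold indicator; split_ifs <;> norm_num

theorem scottContinuous_indicator (U : ScottOpens D) : ScottContinuous U.indicator := by
  obtain ⟨hU, hI⟩ := U.isUpperSet_and_dirSupInacc
  have mono : Monotone U.indicator := fun a b hab => by
    by_cases ha : Topology.WithScott.toScott a ∈ U
    · have hb : Topology.WithScott.toScott b ∈ U := hU hab ha
      simp [indicator, ha, hb]
    · simpa [indicator, ha] using U.indicator_nonneg b
  intro d hne hd a ha
  refine ⟨?_, fun c hc => ?_⟩
  · rintro _ ⟨x, hx, rfl⟩
    exact mono (ha.1 hx)
  · by_cases haU : Topology.WithScott.toScott a ∈ U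
    · obtain ⟨x, hx, hxU⟩ := hI hne hd ha haU
      have hxU : Topology.WithScott.toScott x ∈ U := hxU
      have := hc ⟨x, hx, rfl⟩
      simpa [indicator, haU, hxU] using this
    · obtain ⟨x, hx⟩ := hne
      have := (U.indicator_nonneg x).trans (hc ⟨x, hx, rfl⟩)
      simpa [indicator, haU] using this

/-- A point of a union of open sets lies in one of them. This is the Scott continuity of the Dirac
valuation at `x`. -/
theorem scottContinuous_indicator_right (x : D) :
    ScottContinuous fun U : ScottOpens D => U.indicator x := by
  intro d hne hd U hU
  have mono : Monotone fun U : ScottOpens D => U.indicator x := fun U V hUV => by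
    by_cases ha : Topology.WithScott.toScott x ∈ U
    · have hb : Topology.WithScott.toScott x ∈ V := hUV ha
      simp [indicator, ha, hb]
    · simpa [indicator, ha] using V.indicator_nonneg x
  refine ⟨?_, fun c hc => ?_⟩
  · rintro _ ⟨x, hx, rfl⟩
    exact mono (hU.1 hx)
  · by_cases hx : Topology.WithScott.toScott x ∈ U
    · rw [← hU.sSup_eq, TopologicalSpace.Opens.mem_sSup] at hx
      obtain ⟨V, hV, hxV⟩ := hx
      have h1 := hc ⟨V, hV, rfl⟩
      have h2 : (1 : ℝ) ≤ c := by simpa [indicator, hxV] using h1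
      exact (U.indicator_le_one x).trans h2
    · obtain ⟨V, hV⟩ := hne
      have := (V.indicator_nonneg x).trans (hc ⟨V, hV, rfl⟩)
      simpa [indicator, hx] using this

theorem indicator_modular (U V : ScottOpens D) (x : D) :
    U.indicator x + V.indicator x = (U ⊔ V).indicator x + (U ⊓ V).indicator x := by
  by_cases h1 : Topology.WithScott.toScott x ∈ U <;>
  by_cases h2 : Topology.WithScott.toScott x ∈ V <;>
  simp [indicator, h1, h2]

end ScottOpens

/-! ### Bounds, monotonicity and integrability -/

namespace SubprobValuation

variable {D : Type u} [PartialOrder D]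

theorem mono (ν : SubprobValuation D) {U V : ScottOpens D} (h : U ≤ V) : (ν U : ℝ) ≤ ν V :=
  ν.scottContinuous.monotone h

theorem nonneg (ν : SubprobValuation D) (U : ScottOpens D) : (0 : ℝ) ≤ ν U := (ν U).2.1

theorem le_one (ν : SubprobValuation D) (U : ScottOpens D) : (ν U : ℝ) ≤ 1 := (ν U).2.2

theorem antitone_superlevel (ν : SubprobValuation D) (h : D → ℝ) :
    Antitone fun t : ℝ => (ν (ScottOpens.interior {x | t < h x}) : ℝ) :=
  fun _ _ hst => ν.mono (ScottOpens.interior_mono fun _ hx => lt_of_le_of_lt hst hx)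

theorem intervalIntegrable_superlevel (ν : SubprobValuation D) (h : D → ℝ) (a b : ℝ) :
    IntervalIntegrable (fun t : ℝ => (ν (ScottOpens.interior {x | t < h x}) : ℝ))
      MeasureTheory.volume a b :=
  (ν.antitone_superlevel h).intervalIntegrable

/-! ### Riemann sums -/

/-- The lower Riemann sum of mesh `1 / n` of the integral of `h`. -/
noncomputable def riemann (ν : SubprobValuation D) (h : D → ℝ) (n : ℕ) : ℝ :=
  (∑ i ∈ Finset.range n, (ν (ScottOpens.interior {x | ((i + 1 : ℕ) : ℝ) / n < h x}) : ℝ)) / n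

/-- Rescaling moves the nodes `i / n` to integers, where the comparison of sums and integrals of
antitone functions applies. -/
theorem integral_eq_div (ν : SubprobValuation D) (h : D → ℝ) {n : ℕ} (hn : n ≠ 0) :
    ν.integral h =
      (∫ s in (0 : ℝ)..n, (ν (ScottOpens.interior {x | s / n < h x}) : ℝ)) / n := by
  have hn' : (n : ℝ) ≠ 0 := Nat.cast_ne_zero.2 hn
  have := intervalIntegral.integral_comp_div (a := 0) (b := n)
    (fun t : ℝ => (ν (ScottOpens.interior {x | t < h x}) : ℝ)) hn'
  rw [this, zero_div, div_self hn', smul_eq_mul, mul_div_cancel_left₀ _ hn']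
  rfl

theorem antitone_superlevel_div (ν : SubprobValuation D) (h : D → ℝ) (n : ℕ) :
    Antitone fun s : ℝ => (ν (ScottOpens.interior {x | s / n < h x}) : ℝ) :=
  fun _ _ hst => ν.antitone_superlevel h (by gcongr)

theorem riemann_le_integral (ν : SubprobValuation D) (h : D → ℝ) {n : ℕ} (hn : n ≠ 0) :
    ν.riemann h n ≤ ν.integral h := by
  rw [ν.integral_eq_div h hn, riemann]
  gcongr
  simpa using ((ν.antitone_superlevel_div h n).antitoneOn _).sum_le_integral (x₀ := 0) (a := n)

theorem integral_le_riemann (ν : SubprobValuation D) (h : D → ℝ) {n : ℕ} (hn : n ≠ 0) :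
    ν.integral h ≤ ν.riemann h n + 1 / n := by
  rw [ν.integral_eq_div h hn, riemann, ← add_div]
  gcongr
  have h1 := ((ν.antitone_superlevel_div h n).antitoneOn _).integral_le_sum (x₀ := 0) (a := n)
  rw [zero_add] at h1
  refine h1.trans ?_
  simp only [zero_add]
  -- The upper sum over nodes `0, …, n - 1` and the lower sum over `1, …, n` differ only in their
  -- end terms, which lie in `[0, 1]`.
  have h2 := Finset.sum_range_succ'
    (fun i : ℕ => (ν (ScottOpens.interior {x | (i : ℝ) / n < h x}) : ℝ)) n
  have h3 := Finset.sum_range_succ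
    (fun i : ℕ => (ν (ScottOpens.interior {x | (i : ℝ) / n < h x}) : ℝ)) n
  have h4 := ν.le_one (ScottOpens.interior {x | ((0 : ℕ) : ℝ) / n < h x})
  have h5 := ν.nonneg (ScottOpens.interior {x | (n : ℝ) / n < h x})
  linarith

theorem integral_mono (ν : SubprobValuation D) {h k : D → ℝ} (hk : ∀ x, h x ≤ k x) :
    ν.integral h ≤ ν.integral k :=
  intervalIntegral.integral_mono_on zero_le_one (ν.intervalIntegrable_superlevel h 0 1)
    (ν.intervalIntegrable_superlevel k 0 1)
    fun _ _ => ν.mono (ScottOpens.interior_mono fun x hx => lt_of_lt_of_le hx (hk x))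

theorem integral_nonneg (ν : SubprobValuation D) (h : D → ℝ) : 0 ≤ ν.integral h :=
  intervalIntegral.integral_nonneg zero_le_one fun _ _ => ν.nonneg _

theorem integral_le_one (ν : SubprobValuation D) (h : D → ℝ) : ν.integral h ≤ 1 := by
  have := intervalIntegral.integral_mono_on zero_le_one (ν.intervalIntegrable_superlevel h 0 1)
    (intervalIntegrable_const (c := (1 : ℝ))) fun _ _ => ν.le_one _
  simpa [integral] using this

/-- Adding `c` shifts the window of levels from `[0, 1]` to `[-c, 1 - c]`; the new piece `[-c, 0]`
contributes at most `c`, and dropping `[1 - c, 1]` only loses. -/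
theorem integral_add_const_le (ν : SubprobValuation D) (h : D → ℝ) {c : ℝ} (hc : 0 ≤ c) :
    ν.integral (fun x => h x + c) ≤ ν.integral h + c := by
  let G : ℝ → ℝ := fun t => ν (ScottOpens.interior {x | t < h x})
  have hG : ∀ a b, IntervalIntegrable G MeasureTheory.volume a b :=
    ν.intervalIntegrable_superlevel h
  have h1 : ν.integral (fun x => h x + c) = ∫ t in (0 : ℝ)..1, G (t - c) := by
    simp only [integral, G, sub_lt_iff_lt_add]
  have h2 : (∫ t in (0 - c)..0, G t) + ∫ t in (0 : ℝ)..(1 - c), G t = ∫ t in (0 - c)..(1 - c), G t :=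
    intervalIntegral.integral_add_adjacent_intervals (hG _ _) (hG _ _)
  have h3 : (∫ t in (0 : ℝ)..(1 - c), G t) + ∫ t in (1 - c)..1, G t = ∫ t in (0 : ℝ)..1, G t :=
    intervalIntegral.integral_add_adjacent_intervals (hG _ _) (hG _ _)
  have h4 : 0 ≤ ∫ t in (1 - c)..1, G t :=
    intervalIntegral.integral_nonneg (by linarith) fun _ _ => ν.nonneg _
  have h5 : ∫ t in (0 - c)..0, G t ≤ ∫ t in (0 - c)..0, (1 : ℝ) :=
    intervalIntegral.integral_mono_on (by linarith) (hG _ _) intervalIntegrable_const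
      fun _ _ => ν.le_one _
  rw [intervalIntegral.integral_const, smul_eq_mul, mul_one] at h5
  rw [h1, intervalIntegral.integral_comp_sub_right, ← h2]
  change _ ≤ (∫ t in (0 : ℝ)..1, G t) + c
  linarith

/-! ### Pointwise suprema -/

/-- The pointwise supremum of a directed set of valuations. -/
noncomputable def dirSup (d : Set (SubprobValuation D)) (hne : d.Nonempty)
    (hd : DirectedOn (· ≤ ·) d) : SubprobValuation D where
  toFun U := sSup ((fun ν : SubprobValuation D => ν U) '' d)
  scottContinuous c hc hcd U hU := by
    refine ⟨?_, fun b hb => sSup_le ?_⟩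
    · rintro _ ⟨V, hV, rfl⟩
      refine sSup_le ?_
      rintro _ ⟨ν, hν, rfl⟩
      exact (ν.scottContinuous.monotone (hU.1 hV)).trans (le_sSup ⟨ν, hν, rfl⟩)
    · rintro _ ⟨ν, hν, rfl⟩
      refine (ν.scottContinuous hc hcd hU).2 ?_
      rintro _ ⟨V, hV, rfl⟩
      have hle : ν V ≤ sSup ((fun μ : SubprobValuation D => μ V) '' d) := le_sSup ⟨ν, hν, rfl⟩
      exact hle.trans (hb ⟨V, hV, rfl⟩)
  strict := by
    refine le_antisymm (sSup_le ?_) bot_le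
    rintro _ ⟨ν, _, rfl⟩
    exact ν.strict.le
  modular U V := by
    have : Nonempty d := hne.to_subtype
    have : IsDirectedOrder d := ⟨hd.directed_val⟩
    -- Indexed by the directed set `d` itself, the values on `W` form a monotone net converging to
    -- their supremum, so modularity passes to the limit.
    have key : ∀ W : ScottOpens D, Filter.Tendsto (fun ν : d => (ν.1 W : ℝ)) Filter.atTop
        (nhds ((sSup ((fun ν : SubprobValuation D => ν W) '' d) : unitInterval) : ℝ)) := by
      intro W
      refine tendsto_atTop_isLUB (fun ν μ hνμ => hνμ W) ?_
      have := isLUB_coe_unitInterval (hne.image _)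
        (isLUB_sSup ((fun ν : SubprobValuation D => ν W) '' d))
      rwa [Set.image_image, Set.image_eq_range] at this
    refine tendsto_nhds_unique ((key U).add (key V)) ?_
    exact ((key _).add (key _)).congr fun ν => (ν.1.modular U V).symm

theorem isLUB_dirSup (d : Set (SubprobValuation D)) (hne : d.Nonempty)
    (hd : DirectedOn (· ≤ ·) d) : IsLUB d (dirSup d hne hd) := by
  refine ⟨fun ν hν U => le_sSup ⟨ν, hν, rfl⟩, fun μ hμ U => sSup_le ?_⟩
  rintro _ ⟨ν, hν, rfl⟩
  exact hμ hν U

theorem scottContinuous_apply (U : ScottOpens D) :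
    ScottContinuous fun ν : SubprobValuation D => ν U := by
  intro d hne hd ν hν
  rw [hν.unique (isLUB_dirSup d hne hd)]
  exact isLUB_sSup _

/-- Separate Scott continuity suffices for joint Scott continuity on a product. -/
theorem scottContinuous_eval :
    ScottContinuous fun p : SubprobValuation D × ScottOpens D => (p.1 p.2 : ℝ) :=
  ScottContinuous.comp
    (.fromProd (f := fun p : SubprobValuation D × ScottOpens D => p.1 p.2)
      (fun ν => ν.scottContinuous) scottContinuous_apply)
    scottContinuous_coe_unitInterval

theorem scottContinuous_of_apply {A : Type*} [Preorder A] {N : A → SubprobValuation D}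
    (hN : ∀ U, ScottContinuous fun a => (N a U : ℝ)) : ScottContinuous N := by
  intro d hne hd a ha
  refine ⟨?_, fun μ hμ U => ?_⟩
  · rintro _ ⟨b, hb, rfl⟩
    exact fun U => (hN U).monotone (ha.1 hb)
  · refine (hN U hne hd ha).2 ?_
    rintro _ ⟨b, hb, rfl⟩
    exact hμ ⟨b, hb, rfl⟩ U

end SubprobValuation

/-! ### Scott continuity of the integral -/

theorem ScottContinuous.add_real {A : Type*} [Preorder A] {f g : A → ℝ} (hf : ScottContinuous f)
    (hg : ScottContinuous g) : ScottContinuous fun a => f a + g a := by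
  intro d hne hd a ha
  have : Nonempty d := hne.to_subtype
  have : IsDirectedOrder d := ⟨hd.directed_val⟩
  have key : ∀ {k : A → ℝ}, ScottContinuous k →
      Filter.Tendsto (fun x : d => k x) Filter.atTop (nhds (k a)) := by
    intro k hk
    refine tendsto_atTop_isLUB (fun x y hxy => hk.monotone hxy) ?_
    have := hk hne hd ha
    rwa [Set.image_eq_range] at this
  have h := isLUB_of_tendsto_atTop (f := fun x : d => f x + g x)
    (fun x y hxy => add_le_add (hf.monotone hxy) (hg.monotone hxy)) ((key hf).add (key hg))
  rwa [Set.image_eq_range]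

theorem ScottContinuous.sum_real {A ι : Type*} [Preorder A] {f : ι → A → ℝ} (s : Finset ι)
    (hf : ∀ i ∈ s, ScottContinuous (f i)) : ScottContinuous fun a => ∑ i ∈ s, f i a := by
  classical
  induction s using Finset.induction_on with
  | empty => simp
  | insert i s hi ih =>
    simp only [Finset.sum_insert hi]
    exact (hf i (Finset.mem_insert_self i s)).add_real
      (ih fun j hj => hf j (Finset.mem_insert_of_mem hj))

theorem ScottContinuous.div_real {A : Type*} [Preorder A] {f : A → ℝ} (hf : ScottContinuous f)
    {c : ℝ} (hc : 0 < c) : ScottContinuous fun a => f a / c := by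
  intro d hne hd a ha
  refine ⟨?_, fun b hb => ?_⟩
  · rintro _ ⟨x, hx, rfl⟩
    exact div_le_div_of_nonneg_right (hf.monotone (ha.1 hx)) hc.le
  · rw [div_le_iff₀ hc]
    refine (hf hne hd ha).2 ?_
    rintro _ ⟨x, hx, rfl⟩
    exact (div_le_iff₀ hc).1 (hb ⟨x, hx, rfl⟩)

/-- The one limit argument behind all Riemann sum estimates: an error of order `1 / n` may be
dropped. -/
theorem le_of_forall_le_add_div {a b : ℝ} (c : ℝ) (h : ∀ n : ℕ, n ≠ 0 → a ≤ b + c / n) :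
    a ≤ b := by
  have h1 : Filter.Tendsto (fun n : ℕ => b + c / n) Filter.atTop (nhds (b + 0)) :=
    tendsto_const_nhds.add (tendsto_const_div_atTop_nhds_zero_nat c)
  rw [add_zero] at h1
  exact ge_of_tendsto h1 (Filter.eventually_atTop.2 ⟨1, fun n hn => h n (by omega)⟩)

namespace SubprobValuation

variable {D E : Type u} [PartialOrder D] [PartialOrder E]

/-- For each `n` the Riemann sum is a finite combination of evaluations, hence Scott-continuous in
the parameter, and it approximates the integral within `1 / n` for all parameters at once. -/
theorem scottContinuous_integral {A : Type*} [PartialOrder A] {N : A → SubprobValuation D}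
    (hN : ScottContinuous N) {h : A × D → ℝ} (hh : ScottContinuous h) :
    ScottContinuous fun a => (N a).integral fun x => h (a, x) := by
  have hG : ∀ t : ℝ, ScottContinuous fun a =>
      (N a (ScottOpens.interior {x | t < h (a, x)}) : ℝ) := fun t =>
    (hN.prodMk (ScottOpens.scottContinuous_superlevel hh t)).comp scottContinuous_eval
  have mono : Monotone fun a => (N a).integral fun x => h (a, x) := fun a b hab =>
    intervalIntegral.integral_mono_on zero_le_one (intervalIntegrable_superlevel _ _ 0 1)
      (intervalIntegrable_superlevel _ _ 0 1) fun t _ => (hG t).monotone hab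
  intro d hne hd a ha
  refine ⟨?_, fun c hc => le_of_forall_le_add_div 1 fun n hn => ?_⟩
  · rintro _ ⟨b, hb, rfl⟩
    exact mono (ha.1 hb)
  · have hR : ScottContinuous fun a => (N a).riemann (fun x => h (a, x)) n :=
      (ScottContinuous.sum_real _ fun i _ => hG _).div_real
        (Nat.cast_pos.2 (Nat.pos_of_ne_zero hn))
    refine (integral_le_riemann _ _ hn).trans (add_le_add_left ((hR hne hd ha).2 ?_) _)
    rintro _ ⟨b, hb, rfl⟩
    exact (riemann_le_integral _ _ hn).trans (hc ⟨b, hb, rfl⟩)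

/-! ### Averages -/

/-- `W j` is the set of points lying in more than `j` of the `U i`. Counting points by multiplicity
gives the equality of sums for a measure; for a valuation, modularity gives it by induction on `s`.
-/
theorem sum_apply_superlevel_count {ι : Type*} (ν : SubprobValuation D) (U : ι → ScottOpens D)
    (s : Finset ι) :
    ∃ W : ℕ → ScottOpens D,
      (∀ j x, Topology.WithScott.toScott x ∈ W j ↔ (j : ℝ) < ∑ i ∈ s, (U i).indicator x) ∧
      ∑ j ∈ Finset.range s.card, (ν (W j) : ℝ) = ∑ i ∈ s, (ν (U i) : ℝ) := by
  classical
  induction s using Finset.induction_on with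
  | empty => exact ⟨fun _ => ⊥, fun j x => by simp, by simp⟩
  | insert i s hi ih =>
    obtain ⟨W, hW, hsum⟩ := ih
    have hanti : ∀ j, W (j + 1) ≤ W j := fun j x hx => by
      have := (hW (j + 1) (Topology.WithScott.ofScott x)).1 hx
      refine (hW j (Topology.WithScott.ofScott x)).2 (lt_trans ?_ this)
      push_cast
      linarith
    -- After adding `U i`, a point has more than `j + 1` hits if it already had, or if it had more
    -- than `j` and lies in `U i`.
    let W' : ℕ → ScottOpens D := fun j => Nat.casesOn j (W 0 ⊔ U i) fun j => W (j + 1) ⊔ (W j ⊓ U i)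
    -- The correction `ν (W M ⊓ U i)` is absorbed by modularity at the next level, since `W`
    -- decreases; it vanishes at `M = s.card`, where `W` is empty.
    have tele : ∀ M, ∑ j ∈ Finset.range (M + 1), (ν (W' j) : ℝ) =
        ∑ j ∈ Finset.range (M + 1), (ν (W j) : ℝ) + ν (U i) - ν (W M ⊓ U i) := by
      intro M
      induction M with
      | zero =>
        have := ν.modular (W 0) (U i)
        rw [zero_add, Finset.sum_range_one, Finset.sum_range_one]
        change (ν (W 0 ⊔ U i) : ℝ) = _
        linarith
      | succ M ihM =>
        have := ν.modular (W (M + 1)) (W M ⊓ U i)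
        rw [← inf_assoc, inf_eq_left.2 (hanti M)] at this
        rw [Finset.sum_range_succ, ihM, Finset.sum_range_succ _ (M + 1)]
        change _ + (ν (W (M + 1) ⊔ (W M ⊓ U i)) : ℝ) = _
        linarith
    have hbot : W s.card = ⊥ := by
      refine ScottOpens.ext_mem fun x => (hW _ x).trans (iff_of_false (not_lt.2 ?_) id)
      simpa using Finset.sum_le_card_nsmul s _ 1 fun i _ => (U i).indicator_le_one x
    refine ⟨W', fun j x => ?_, ?_⟩
    · rw [Finset.sum_insert hi]
      have h0 : 0 ≤ ∑ i ∈ s, (U i).indicator x :=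
        Finset.sum_nonneg fun i _ => (U i).indicator_nonneg x
      have hWx := fun j => hW j x
      cases j with
      | zero =>
        change _ ∈ W 0 ⊔ U i ↔ _
        rw [← SetLike.mem_coe, TopologicalSpace.Opens.coe_sup, Set.mem_union, SetLike.mem_coe,
          SetLike.mem_coe, hWx]
        by_cases hx : Topology.WithScott.toScott x ∈ U i
        · simp only [hx, ScottOpens.indicator, or_true, if_true, true_iff] at h0 ⊢
          push_cast
          linarith
        · simp [hx, ScottOpens.indicator]
      | succ j =>
        change _ ∈ W (j + 1) ⊔ (W j ⊓ U i) ↔ _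
        rw [← SetLike.mem_coe, TopologicalSpace.Opens.coe_sup, TopologicalSpace.Opens.coe_inf,
          Set.mem_union, Set.mem_inter_iff, SetLike.mem_coe, SetLike.mem_coe, SetLike.mem_coe,
          hWx, hWx]
        push_cast
        by_cases hx : Topology.WithScott.toScott x ∈ U i
        · have hI : (U i).indicator x = 1 := by simp [ScottOpens.indicator, hx]
          rw [hI]
          simp only [hx, and_true]
          constructor
          · rintro (h | h) <;> linarith
          · intro h
            right
            linarith
        · simp [hx, ScottOpens.indicator]
    · rw [Finset.card_insert_of_notMem hi, tele, Finset.sum_range_succ, hsum, hbot, bot_inf_eq,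
        ν.strict, Finset.sum_insert hi]
      simp
      ring

/-- The average takes only values that are multiples of `1 / s.card`, so its superlevel set is
constant between consecutive multiples and the integral is an exact finite sum. -/
theorem card_mul_integral_indicator {ι : Type*} (ν : SubprobValuation D) (U : ι → ScottOpens D)
    {s : Finset ι} (hs : s.Nonempty) :
    (s.card : ℝ) * ν.integral (fun x => (∑ i ∈ s, (U i).indicator x) / s.card) =
      ∑ i ∈ s, (ν (U i) : ℝ) := by
  obtain ⟨W, hW, hsum⟩ := ν.sum_apply_superlevel_count U s
  have hn : (s.card : ℝ) ≠ 0 := by simpa using hs.ne_empty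
  rw [ν.integral_eq_div _ hs.card_ne_zero, mul_div_cancel₀ _ hn, ← hsum]
  have hanti := ν.antitone_superlevel_div (fun x => (∑ i ∈ s, (U i).indicator x) / s.card) s.card
  have hadj := intervalIntegral.sum_integral_adjacent_intervals (n := s.card)
    (a := fun k : ℕ => (k : ℝ)) (μ := MeasureTheory.volume)
    (fun k _ => hanti.intervalIntegrable (a := ((k : ℕ) : ℝ)) (b := ((k + 1 : ℕ) : ℝ)))
  rw [Nat.cast_zero] at hadj
  rw [← hadj]
  refine Finset.sum_congr rfl fun j _ => ?_
  have hcont : ScottContinuous fun x => (∑ i ∈ s, (U i).indicator x) / (s.card : ℝ) :=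
    (ScottContinuous.sum_real s fun i _ => (U i).scottContinuous_indicator).div_real
      (Nat.cast_pos.2 hs.card_pos)
  have hconst : ∫ t in (j : ℝ)..((j + 1 : ℕ) : ℝ), (ν (ScottOpens.interior
      {x | t / s.card < (∑ i ∈ s, (U i).indicator x) / s.card}) : ℝ) =
      ∫ _ in (j : ℝ)..((j + 1 : ℕ) : ℝ), (ν (W j) : ℝ) := by
    refine intervalIntegral.integral_congr_Ioo_of_le (by simp) fun t ht => ?_
    have hset : ScottOpens.interior
        {x | t / s.card < (∑ i ∈ s, (U i).indicator x) / s.card} = W j := by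
      refine ScottOpens.ext_mem fun x => ?_
      rw [ScottOpens.mem_interior_lt hcont, hW,
        div_lt_div_iff_of_pos_right (Nat.cast_pos.2 hs.card_pos)]
      classical
      -- Integrality of the count makes `t < count` and `j < count` equivalent for `j < t < j + 1`.
      have hnat : ∑ i ∈ s, (U i).indicator x =
          ((s.filter fun i => Topology.WithScott.toScott x ∈ U i).card : ℕ) := by
        simp [ScottOpens.indicator]
      rw [hnat]
      refine ⟨ht.1.trans, fun hlt => ht.2.trans_le ?_⟩
      exact_mod_cast hlt
    simp only [hset]
  rw [hconst]
  simp

theorem integral_indicator (ν : SubprobValuation D) (U : ScottOpens D) :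
    ν.integral U.indicator = ν U := by
  simpa using ν.card_mul_integral_indicator (fun _ : Unit => U) (s := Finset.univ)
    Finset.univ_nonempty

/-! ### Dirac valuations -/

/-- The Dirac valuation at `x`. -/
noncomputable def dirac (x : D) : SubprobValuation D where
  toFun U := ⟨U.indicator x, U.indicator_nonneg x, U.indicator_le_one x⟩
  scottContinuous := .of_coe_unitInterval (ScottOpens.scottContinuous_indicator_right x)
  strict := Subtype.ext (by simp [ScottOpens.indicator])
  modular U V := U.indicator_modular V x

theorem dirac_apply (x : D) (U : ScottOpens D) : (dirac x U : ℝ) = U.indicator x := rfl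

theorem scottContinuous_dirac : ScottContinuous (dirac (D := D)) :=
  scottContinuous_of_apply fun U => U.scottContinuous_indicator

theorem integral_dirac (x : D) {h : D → ℝ} (hh : ScottContinuous h)
    (h01 : h x ∈ Set.Icc (0 : ℝ) 1) : (dirac x).integral h = h x := by
  have hmem : ∀ t, Topology.WithScott.toScott x ∈ ScottOpens.interior {x | t < h x} ↔ t < h x :=
    fun t => ScottOpens.mem_interior_lt hh t
  rw [integral, ← intervalIntegral.integral_add_adjacent_intervals
    (intervalIntegrable_superlevel _ h 0 (h x)) (intervalIntegrable_superlevel _ h (h x) 1)]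
  have h1 : ∫ t in (0 : ℝ)..h x, (dirac x (ScottOpens.interior {x | t < h x}) : ℝ) =
      ∫ _ in (0 : ℝ)..h x, (1 : ℝ) :=
    intervalIntegral.integral_congr_Ioo_of_le h01.1 fun t ht => by
      simp only [dirac_apply, ScottOpens.indicator, hmem, if_pos ht.2]
  have h2 : ∫ t in h x..1, (dirac x (ScottOpens.interior {x | t < h x}) : ℝ) =
      ∫ _ in h x..1, (0 : ℝ) :=
    intervalIntegral.integral_congr_Ioo_of_le h01.2 fun t ht => by
      simp only [dirac_apply, ScottOpens.indicator, hmem, if_neg ht.1.not_gt]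
  rw [h1, h2]
  simp

/-! ### Linearity -/

/-- The integral commutes with averages of finite families. -/
theorem card_mul_integral_average {ι : Type*} (ν : SubprobValuation D) {h : ι → D → ℝ}
    {s : Finset ι} (hs : s.Nonempty) (hh : ∀ i ∈ s, ScottContinuous (h i))
    (h01 : ∀ i ∈ s, ∀ x, h i x ∈ Set.Icc (0 : ℝ) 1) :
    (s.card : ℝ) * ν.integral (fun x => (∑ i ∈ s, h i x) / s.card) =
      ∑ i ∈ s, ν.integral (h i) := by
  have hm : (0 : ℝ) < s.card := Nat.cast_pos.2 hs.card_pos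
  suffices key : ∀ n : ℕ, n ≠ 0 →
      (s.card : ℝ) * ν.integral (fun x => (∑ i ∈ s, h i x) / s.card) ≤
        ∑ i ∈ s, ν.integral (h i) + (s.card : ℝ) / n ∧
      ∑ i ∈ s, ν.integral (h i) ≤
        (s.card : ℝ) * ν.integral (fun x => (∑ i ∈ s, h i x) / s.card) + (s.card : ℝ) / n from
    le_antisymm (le_of_forall_le_add_div _ fun n hn => (key n hn).1)
      (le_of_forall_le_add_div _ fun n hn => (key n hn).2)
  intro n hn
  have hn' : (0 : ℝ) < n := Nat.cast_pos.2 (Nat.pos_of_ne_zero hn)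
  let U : ι × ℕ → ScottOpens D :=
    fun p => ScottOpens.interior {x | ((p.2 + 1 : ℕ) : ℝ) / n < h p.1 x}
  -- Integrating against `dirac x` is evaluation at `x`, so its Riemann sum is the lower staircase
  -- approximation of `h i x`, and the Riemann bounds become pointwise bounds.
  let g : D → ℝ := fun x => (∑ i ∈ s, (dirac x).riemann (h i) n) / s.card
  have hg1 : ∀ x, g x ≤ (∑ i ∈ s, h i x) / s.card := fun x =>
    div_le_div_of_nonneg_right (Finset.sum_le_sum fun i hi =>
      (riemann_le_integral _ _ hn).trans_eq (integral_dirac x (hh i hi) (h01 i hi x))) hm.le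
  have hg2 : ∀ x, (∑ i ∈ s, h i x) / s.card ≤ g x + 1 / n := fun x => by
    have : ∑ i ∈ s, h i x ≤ ∑ i ∈ s, ((dirac x).riemann (h i) n + 1 / n) :=
      Finset.sum_le_sum fun i hi =>
        (integral_dirac x (hh i hi) (h01 i hi x)).symm.le.trans (integral_le_riemann _ _ hn)
    rw [Finset.sum_add_distrib, Finset.sum_const, nsmul_eq_mul] at this
    refine (div_le_div_of_nonneg_right this hm.le).trans_eq ?_
    rw [add_div, mul_div_cancel_left₀ _ hm.ne']
  -- `g` is an average of `s.card * n` indicators, whose integral is known exactly.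
  have hgint : (s.card : ℝ) * ν.integral g = ∑ i ∈ s, ν.riemann (h i) n := by
    have hne : (s ×ˢ Finset.range n).Nonempty :=
      hs.product (Finset.nonempty_range_iff.2 hn)
    have h1 := ν.card_mul_integral_indicator U hne
    have h2 : (fun x => (∑ p ∈ s ×ˢ Finset.range n, (U p).indicator x) /
        ((s ×ˢ Finset.range n).card : ℝ)) = g := by
      funext x
      simp only [g, riemann, dirac_apply, ← Finset.sum_div, Finset.sum_product, U,
        Finset.card_product, Finset.card_range, Nat.cast_mul, div_div]
      rw [mul_comm]
    rw [h2] at h1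
    simp only [riemann, ← Finset.sum_div]
    rw [eq_div_iff hn'.ne']
    rw [Finset.sum_product, Finset.card_product, Finset.card_range, Nat.cast_mul] at h1
    rw [← h1]
    ring
  have i1 := mul_le_mul_of_nonneg_left (ν.integral_mono hg1) hm.le
  have i2 := mul_le_mul_of_nonneg_left ((ν.integral_mono hg2).trans
    (ν.integral_add_const_le g (by positivity : (0 : ℝ) ≤ 1 / n))) hm.le
  have r1 : ∑ i ∈ s, ν.riemann (h i) n ≤ ∑ i ∈ s, ν.integral (h i) :=
    Finset.sum_le_sum fun i _ => riemann_le_integral _ _ hn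
  have r2 : ∑ i ∈ s, ν.integral (h i) ≤ ∑ i ∈ s, ν.riemann (h i) n + s.card / n := by
    refine (Finset.sum_le_sum fun i _ => ν.integral_le_riemann (h i) hn).trans_eq ?_
    rw [Finset.sum_add_distrib, Finset.sum_const, nsmul_eq_mul, mul_one_div]
  rw [mul_add, mul_one_div] at i2
  constructor <;> linarith

/-- Sums may leave `[0, 1]`, where `integral` truncates, so both sides are halved first. This yields
modularity of `bind`. -/
theorem integral_add_eq_of_add_eq (ν : SubprobValuation D) {a b c d : D → ℝ}
    (ha : ScottContinuous a) (hb : ScottContinuous b) (hc : ScottContinuous c)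
    (hd : ScottContinuous d) (ha1 : ∀ x, a x ∈ Set.Icc (0 : ℝ) 1)
    (hb1 : ∀ x, b x ∈ Set.Icc (0 : ℝ) 1) (hc1 : ∀ x, c x ∈ Set.Icc (0 : ℝ) 1)
    (hd1 : ∀ x, d x ∈ Set.Icc (0 : ℝ) 1) (h : ∀ x, a x + b x = c x + d x) :
    ν.integral a + ν.integral b = ν.integral c + ν.integral d := by
  have key : ∀ {f g : D → ℝ}, ScottContinuous f → ScottContinuous g →
      (∀ x, f x ∈ Set.Icc (0 : ℝ) 1) → (∀ x, g x ∈ Set.Icc (0 : ℝ) 1) →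
      ν.integral f + ν.integral g = 2 * ν.integral fun x => (f x + g x) / 2 := by
    intro f g hf hg hf1 hg1
    have := ν.card_mul_integral_average (h := fun i : Bool => if i then f else g)
      (s := Finset.univ) Finset.univ_nonempty
      (fun i _ => by cases i <;> simpa) (fun i _ => by cases i <;> simpa)
    simpa using this.symm
  rw [key ha hb ha1 hb1, key hc hd hc1 hd1]
  simp only [h]

/-! ### Kleisli extension -/

theorem scottContinuous_eval_comp {f : D → SubprobValuation E} (hf : ScottContinuous f)
    (U : ScottOpens E) : ScottContinuous fun x => (f x U : ℝ) :=
  (hf.comp (scottContinuous_apply U)).comp scottContinuous_coe_unitInterval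

/-- The Kleisli extension of `f`, applied to `ν`. -/
noncomputable def bind (ν : SubprobValuation D) (f : D → SubprobValuation E)
    (hf : ScottContinuous f) : SubprobValuation E where
  toFun U := ⟨ν.integral fun x => (f x U : ℝ), ν.integral_nonneg _, ν.integral_le_one _⟩
  scottContinuous := by
    refine .of_coe_unitInterval (scottContinuous_integral (ScottContinuous.const ν)
      (h := fun p : ScottOpens E × D => (f p.2 p.1 : ℝ)) ?_)
    exact ((ScottContinuous.snd.comp hf).prodMk ScottContinuous.fst).comp scottContinuous_eval
  strict := by
    refine Subtype.ext (le_antisymm ?_ (ν.integral_nonneg _))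
    have h0 := (ν.integral_indicator ⊥).le
    rw [ν.strict] at h0
    exact (ν.integral_mono fun x => by simp [(f x).strict, ScottOpens.indicator]).trans h0
  modular U V := ν.integral_add_eq_of_add_eq (scottContinuous_eval_comp hf _)
    (scottContinuous_eval_comp hf _) (scottContinuous_eval_comp hf _)
    (scottContinuous_eval_comp hf _) (fun x => (f x _).2) (fun x => (f x _).2)
    (fun x => (f x _).2) (fun x => (f x _).2) fun x => (f x).modular U V

theorem bind_apply (ν : SubprobValuation D) {f : D → SubprobValuation E} (hf : ScottContinuous f)
    (U : ScottOpens E) : (ν.bind f hf U : ℝ) = ν.integral fun x => (f x U : ℝ) := rfl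

theorem ext_apply {ν μ : SubprobValuation D} (h : ∀ U, (ν U : ℝ) = μ U) : ν = μ :=
  SubprobValuation.ext (funext fun U => Subtype.ext (h U))

theorem scottContinuous_bind {A : Type*} [PartialOrder A] {N : A → SubprobValuation D}
    (hN : ScottContinuous N) {f : A → D → SubprobValuation E}
    (hf : ScottContinuous fun p : A × D => f p.1 p.2) (hf' : ∀ a, ScottContinuous (f a)) :
    ScottContinuous fun a => (N a).bind (f a) (hf' a) :=
  scottContinuous_of_apply fun U => scottContinuous_integral hN
    (h := fun p : A × D => (f p.1 p.2 U : ℝ))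
    ((hf.comp (scottContinuous_apply U)).comp scottContinuous_coe_unitInterval)

/-- On Riemann sums the identity is exact, because the integral commutes with averages; each side is
within `1 / n` of its Riemann version. -/
theorem integral_bind (ν : SubprobValuation D) {f : D → SubprobValuation E}
    (hf : ScottContinuous f) (h : E → ℝ) :
    (ν.bind f hf).integral h = ν.integral fun x => (f x).integral h := by
  suffices key : ∀ n : ℕ, n ≠ 0 →
      (ν.bind f hf).integral h ≤ ν.integral (fun x => (f x).integral h) + 1 / n ∧
      ν.integral (fun x => (f x).integral h) ≤ (ν.bind f hf).integral h + 1 / n from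
    le_antisymm (le_of_forall_le_add_div _ fun n hn => (key n hn).1)
      (le_of_forall_le_add_div _ fun n hn => (key n hn).2)
  intro n hn
  have hn' : (n : ℝ) ≠ 0 := Nat.cast_ne_zero.2 hn
  have hR : (ν.bind f hf).riemann h n = ν.integral fun x => (f x).riemann h n := by
    have := ν.card_mul_integral_average (s := Finset.range n)
      (h := fun i x => (f x (ScottOpens.interior {y | ((i + 1 : ℕ) : ℝ) / n < h y}) : ℝ))
      (Finset.nonempty_range_iff.2 hn) (fun _ _ => scottContinuous_eval_comp hf _)
      (fun _ _ x => (f x _).2)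
    rw [Finset.card_range] at this
    rw [riemann, div_eq_iff hn', mul_comm]
    exact this.symm
  have h1 := (ν.bind f hf).riemann_le_integral h hn
  have h2 := (ν.bind f hf).integral_le_riemann h hn
  have h3 := ν.integral_mono fun x => (f x).riemann_le_integral h hn
  have h4 := (ν.integral_mono fun x => (f x).integral_le_riemann h hn).trans
    (ν.integral_add_const_le _ (by positivity))
  constructor <;> linarith

theorem dirac_bind (x : D) {f : D → SubprobValuation E} (hf : ScottContinuous f) :
    (dirac x).bind f hf = f x :=
  ext_apply fun U => integral_dirac x (scottContinuous_eval_comp hf U) (f x U).2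

theorem bind_dirac (ν : SubprobValuation D) : ν.bind dirac scottContinuous_dirac = ν :=
  ext_apply fun U => ν.integral_indicator U

theorem bind_bind {F : Type u} [PartialOrder F] (ν : SubprobValuation D)
    {f : D → SubprobValuation E} (hf : ScottContinuous f) {g : E → SubprobValuation F}
    (hg : ScottContinuous g) :
    (ν.bind f hf).bind g hg = ν.bind (fun x => (f x).bind g hg)
      (scottContinuous_bind hf (ScottContinuous.snd.comp hg) fun _ => hg) :=
  ext_apply fun _ => ν.integral_bind hf _

/-! ### Central valuations -/

theorem IsCentral.integral_comm {ν : SubprobValuation D} (hν : ν.IsCentral) [IsDcpo E]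
    (μ : SubprobValuation E) {h : D × E → ℝ} (hh : ScottContinuous h)
    (h01 : ∀ p, h p ∈ Set.Icc (0 : ℝ) 1) :
    ν.integral (fun x => μ.integral fun y => h (x, y)) =
      μ.integral fun y => ν.integral fun x => h (x, y) :=
  hν (DCPO.of E) μ (fun p => ⟨h p, h01 p⟩) (.of_coe_unitInterval hh)

theorem IsCentral.dirac (x : D) : (dirac x).IsCentral := by
  intro E μ h hh
  have hc : ScottContinuous fun p : D × E => (h p : ℝ) := hh.comp scottContinuous_coe_unitInterval
  refine (integral_dirac x (scottContinuous_integral (ScottContinuous.const μ) hc)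
    ⟨μ.integral_nonneg _, μ.integral_le_one _⟩).trans ?_
  congr 1
  funext y
  exact (integral_dirac x (h := fun x => (h (x, y) : ℝ))
    ((ScottContinuous.id.prodMk (ScottContinuous.const y)).comp hc) (h (x, y)).2).symm

/-- Unfolding the integral against `bind` leaves two swaps: the inner one by centrality of `f x`,
the outer one by centrality of `ν`, applied to an integrand that is Scott-continuous by
`scottContinuous_integral`. -/
theorem IsCentral.bind {ν : SubprobValuation D} (hν : ν.IsCentral) {f : D → SubprobValuation E}
    (hf : ScottContinuous f) (hfc : ∀ x, (f x).IsCentral) : (ν.bind f hf).IsCentral := by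
  intro F μ h hh
  have hc : ScottContinuous fun p : E × F => (h p : ℝ) := hh.comp scottContinuous_coe_unitInterval
  simp only [integral_bind, fun x => hfc x F μ h hh]
  refine hν.integral_comm μ (h := fun p : D × F => (f p.1).integral fun y => (h (y, p.2) : ℝ)) ?_
    fun p => ⟨integral_nonneg _ _, integral_le_one _ _⟩
  exact scottContinuous_integral (ScottContinuous.fst.comp hf)
    (h := fun q : (D × F) × E => (h (q.2, q.1.2) : ℝ))
    ((ScottContinuous.snd.prodMk (ScottContinuous.fst.comp ScottContinuous.snd)).comp hc)

/-- For fixed `μ` and `h`, both iterated integrals are Scott-continuous in `ν`, so their equality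
persists at directed suprema. -/
theorem dirSupClosed_isCentral : DirSupClosed {ν : SubprobValuation D | ν.IsCentral} := by
  intro d hdc hne hd ν hν E μ h hh
  have hc : ScottContinuous fun p : D × E => (h p : ℝ) := hh.comp scottContinuous_coe_unitInterval
  have h1 : ScottContinuous fun ν : SubprobValuation D =>
      ν.integral fun x => μ.integral fun y => (h (x, y) : ℝ) :=
    scottContinuous_integral ScottContinuous.id
      (h := fun p : SubprobValuation D × D => μ.integral fun y => (h (p.2, y) : ℝ))
      (ScottContinuous.snd.comp (scottContinuous_integral (ScottContinuous.const μ) hc))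
  have h2 : ScottContinuous fun ν : SubprobValuation D =>
      μ.integral fun y => ν.integral fun x => (h (x, y) : ℝ) :=
    scottContinuous_integral (ScottContinuous.const μ)
      (h := fun p : SubprobValuation D × E => p.1.integral fun x => (h (x, p.2) : ℝ))
      (scottContinuous_integral ScottContinuous.fst
        (h := fun q : (SubprobValuation D × E) × D => (h (q.2, q.1.2) : ℝ))
        ((ScottContinuous.snd.prodMk (ScottContinuous.fst.comp ScottContinuous.snd)).comp hc))
  refine (h1 hne hd hν).unique ?_
  rw [Set.image_congr fun ρ hρ => hdc hρ E μ h hh]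
  exact h2 hne hd hν

end SubprobValuation

/-! ### Submonads -/

namespace KleisliTriple

variable {C : Type u} [Category.{v} C] {V Z : C → C}

/-- Restriction of a Kleisli triple along a family of monomorphisms. -/
def restrict (K : KleisliTriple V) (i : ∀ X, Z X ⟶ V X) [∀ X, Mono (i X)]
    (unit : ∀ X, X ⟶ Z X) (ext : ∀ {X Y : C}, (X ⟶ Z Y) → (Z X ⟶ Z Y))
    (hunit : ∀ X, unit X ≫ i X = K.unit X)
    (hext : ∀ {X Y : C} (f : X ⟶ Z Y), ext f ≫ i Y = i X ≫ K.ext (f ≫ i Y)) :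
    KleisliTriple Z where
  unit := unit
  ext := ext
  ext_unit X := by
    rw [← cancel_mono (i X), hext, hunit, K.ext_unit, Category.comp_id, Category.id_comp]
  unit_ext {X Y} f := by
    rw [← cancel_mono (i Y), Category.assoc, hext, ← Category.assoc, hunit, K.unit_ext]
  ext_ext {X Y W} f g := by
    rw [← cancel_mono (i W), Category.assoc, hext, ← Category.assoc, hext, Category.assoc,
      K.ext_ext, hext, Category.assoc, Category.assoc, hext]

/-- Rewrites the double strengths as Kleisli extensions, which can be computed with `bind`. -/
theorem map_comp_mu {X Y : C} (K : KleisliTriple V) (f : X ⟶ V Y) :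
    K.toMonad.map f ≫ K.toMonad.μ.app Y = K.ext f := by
  change K.ext (f ≫ K.unit _) ≫ K.ext (𝟙 _) = K.ext f
  rw [K.ext_ext, Category.assoc, K.unit_ext, Category.comp_id]

/-- Maps commuting with the unit and the Kleisli extension form a morphism of monads. -/
def toMonadHom {K : KleisliTriple V} {L : KleisliTriple Z} (i : ∀ X, Z X ⟶ V X)
    (hunit : ∀ X, L.unit X ≫ i X = K.unit X)
    (hext : ∀ {X Y : C} (f : X ⟶ Z Y), L.ext f ≫ i Y = i X ≫ K.ext (f ≫ i Y)) :
    L.toMonad ⟶ K.toMonad where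
  app := i
  naturality X Y f := by
    change L.ext (f ≫ L.unit Y) ≫ i Y = i X ≫ K.ext (f ≫ K.unit Y)
    rw [hext, Category.assoc, hunit]
  app_η := hunit
  app_μ X := by
    change L.ext (𝟙 _) ≫ i X = (L.ext (i X ≫ L.unit _) ≫ i (V X)) ≫ K.ext (𝟙 _)
    rw [hext, hext, Category.assoc, Category.assoc, K.ext_ext, hunit, Category.assoc, K.unit_ext,
      Category.id_comp, Category.comp_id]

end KleisliTriple

/-! ### Strength and commutativity along a monomorphism of monads -/

namespace MonadStrength

section

variable {C : Type u} [Category.{v} C] [MonoidalCategory C] {S T : Monad C}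

theorem whiskerLeft_map_comp_str (t : MonadStrength T) (X : C) {Y Y' : C} (g : Y ⟶ Y') :
    X ◁ T.map g ≫ t.str X Y' = t.str X Y ≫ T.map (X ◁ g) := by
  have := t.naturality (𝟙 X) g
  rwa [id_tensorHom, id_tensorHom] at this

theorem whiskerRight_comp_str (t : MonadStrength T) {X X' : C} (f : X ⟶ X') (Y : C) :
    f ▷ T.obj Y ≫ t.str X' Y = t.str X Y ≫ T.map (f ▷ Y) := by
  have := t.naturality f (𝟙 Y)
  rwa [T.map_id, tensorHom_id, tensorHom_id] at this

/-- Restriction of a strength along a monomorphism of monads. -/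
def restrict (t : MonadStrength T) (i : S ⟶ T) [∀ X, Mono (i.app X)]
    (str : ∀ X Y : C, X ⊗ S.obj Y ⟶ S.obj (X ⊗ Y))
    (hstr : ∀ X Y, str X Y ≫ i.app (X ⊗ Y) = X ◁ i.app Y ≫ t.str X Y) : MonadStrength S where
  str := str
  naturality {X X' Y Y'} f g := by
    rw [← cancel_mono (i.app _), Category.assoc, hstr, Category.assoc, i.naturality,
      reassoc_of% hstr, ← t.naturality, ← id_tensorHom, ← id_tensorHom,
      tensorHom_comp_tensorHom_assoc, tensorHom_comp_tensorHom_assoc, i.naturality]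
    simp
  leftUnitor Y := by
    rw [← cancel_mono (i.app _), Category.assoc, i.naturality, reassoc_of% hstr, t.leftUnitor,
      leftUnitor_naturality]
  associator X Y W := by
    rw [← cancel_mono (i.app _), Category.assoc, i.naturality, reassoc_of% hstr, t.associator,
      Category.assoc, Category.assoc, hstr, ← whiskerLeft_comp_assoc, hstr]
    simp
  unit X Y := by
    rw [← cancel_mono (i.app _), Category.assoc, hstr, ← whiskerLeft_comp_assoc, i.app_η, t.unit,
      i.app_η]
  mult X Y := by
    rw [← cancel_mono (i.app _), Category.assoc, hstr, ← whiskerLeft_comp_assoc, i.app_μ]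
    simp only [Category.assoc, i.app_μ]
    rw [← Functor.map_comp_assoc, hstr, i.naturality_assoc, i.naturality_assoc, reassoc_of% hstr]
    simp only [Functor.map_comp, MonoidalCategory.whiskerLeft_comp, Category.assoc, t.mult]
    rw [← reassoc_of% t.whiskerLeft_map_comp_str]

end

variable {C : Type u} [Category.{v} C] [MonoidalCategory C] [BraidedCategory C] {S T : Monad C}

theorem whiskerLeft_comp_costr (t : MonadStrength T) (X : C) {Y Y' : C} (g : Y ⟶ Y') :
    T.obj X ◁ g ≫ t.costr X Y' = t.costr X Y ≫ T.map (X ◁ g) := by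
  simp only [costr, Category.assoc, ← Functor.map_comp, BraidedCategory.braiding_naturality_left,
    BraidedCategory.braiding_naturality_right_assoc, reassoc_of% whiskerRight_comp_str]

theorem costr_comp_app {s : MonadStrength S} {t : MonadStrength T} {i : S ⟶ T}
    (hstr : ∀ X Y, s.str X Y ≫ i.app (X ⊗ Y) = X ◁ i.app Y ≫ t.str X Y) (X Y : C) :
    s.costr X Y ≫ i.app (X ⊗ Y) = i.app X ▷ Y ≫ t.costr X Y := by
  simp only [costr, Category.assoc, i.naturality, reassoc_of% hstr]
  simp

/-- Naturality moves all inclusions to the front, so the double strengths of `T` need to agree only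
after restriction along `i ⊗ i`; commutativity of `T` itself is not required. -/
theorem isCommutative_of_mono {s : MonadStrength S} {t : MonadStrength T} {i : S ⟶ T}
    [∀ X, Mono (i.app X)]
    (hstr : ∀ X Y, s.str X Y ≫ i.app (X ⊗ Y) = X ◁ i.app Y ≫ t.str X Y)
    (h : ∀ X Y, (i.app X ⊗ₘ i.app Y) ≫
        t.costr X (T.obj Y) ≫ T.map (t.str X Y) ≫ T.μ.app (X ⊗ Y) =
      (i.app X ⊗ₘ i.app Y) ≫
        t.str (T.obj X) Y ≫ T.map (t.costr X Y) ≫ T.μ.app (X ⊗ Y)) :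
    s.IsCommutative := by
  intro X Y
  rw [← cancel_mono (i.app _)]
  simp only [Category.assoc, i.app_μ]
  rw [← Functor.map_comp_assoc, ← Functor.map_comp_assoc, hstr, costr_comp_app hstr,
    i.naturality_assoc, i.naturality_assoc, ← Category.assoc, costr_comp_app hstr,
    reassoc_of% hstr (S.obj X) Y]
  have h' := h X Y
  rw [MonoidalCategory.tensorHom_def, Category.assoc, Category.assoc,
    reassoc_of% whiskerLeft_comp_costr, ← whisker_exchange_assoc, reassoc_of% whiskerRight_comp_str] at h'
  simpa only [Functor.map_comp, Category.assoc] using h'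

end MonadStrength

namespace DCPO

open SubprobValuation

/-! ### The monad of subprobability valuations -/

/-- The Kleisli triple of subprobability valuations. -/
noncomputable def kleisliV : KleisliTriple DCPO.V.{u} where
  unit D := (⟨dirac, scottContinuous_dirac⟩ : ScottHom D (SubprobValuation D))
  ext {D E} f :=
    let f' : ScottHom D (SubprobValuation E) := f
    (⟨fun ν => ν.bind f'.toFun f'.scottContinuous,
      scottContinuous_bind ScottContinuous.id (ScottContinuous.snd.comp f'.scottContinuous)
        fun _ => f'.scottContinuous⟩ : ScottHom (SubprobValuation D) (SubprobValuation E))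
  ext_unit D := hom_ext (D := V D) (E := V D) fun ν => bind_dirac (D := D) ν
  unit_ext {_ _} f := hom_ext fun x => dirac_bind x (ScottHom.scottContinuous f)
  ext_ext {_ _ _} f g := hom_ext fun ν =>
    bind_bind ν (ScottHom.scottContinuous f) (ScottHom.scottContinuous g)

theorem scottContinuous_dirac_mk {D E : Type u} [PartialOrder D] [PartialOrder E] (x : D) :
    ScottContinuous fun y : E => dirac (x, y) :=
  ScottContinuous.comp (f := fun y : E => (x, y))
    ((ScottContinuous.const x).prodMk ScottContinuous.id) scottContinuous_dirac

/-- The strength of the monad of subprobability valuations, on elements. -/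
noncomputable def strengthHom (D E : Type u) [PartialOrder D] [PartialOrder E] :
    ScottHom (D × SubprobValuation E) (SubprobValuation (D × E)) where
  -- Written as a `bind` rather than by slices, so that the strength laws reduce to `bind_bind` and
  -- `dirac_bind`, and centrality is inherited through `IsCentral.bind`.
  toFun p := p.2.bind (fun y => dirac (p.1, y)) (scottContinuous_dirac_mk p.1)
  scottContinuous := scottContinuous_bind ScottContinuous.snd
    (f := fun (p : D × SubprobValuation E) (y : E) => dirac (p.1, y))
    (ScottContinuous.comp (f := fun q : (D × SubprobValuation E) × E => (q.1.1, q.2))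
      ((ScottContinuous.fst.comp ScottContinuous.fst).prodMk ScottContinuous.snd)
      scottContinuous_dirac) fun p => scottContinuous_dirac_mk p.1

/-- Allows changing the integrand although `bind` carries a continuity proof depending on it. -/
theorem bind_congr {D E : Type u} [PartialOrder D] [PartialOrder E] {ν μ : SubprobValuation D}
    {f g : D → SubprobValuation E} {hf : ScottContinuous f} {hg : ScottContinuous g}
    (h : ν = μ) (hfg : ∀ x, f x = g x) : ν.bind f hf = μ.bind g hg := by
  obtain rfl : f = g := funext hfg
  rw [h]

/-- The strength of the monad of subprobability valuations. -/
noncomputable def strengthV : MonadStrength kleisliV.{u}.toMonad where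
  str D E := strengthHom D E
  naturality {X X' Y Y'} f g := hom_ext fun p => by
    obtain ⟨x, ν⟩ : X × SubprobValuation Y := p
    refine (bind_bind ν (ScottHom.scottContinuous (g ≫ kleisliV.unit Y'))
      (scottContinuous_dirac_mk _)).trans (.trans ?_ (bind_bind ν (scottContinuous_dirac_mk _)
        (ScottHom.scottContinuous ((f ⊗ₘ g) ≫ kleisliV.unit (X' ⊗ Y')))).symm)
    exact bind_congr rfl fun y => (dirac_bind _ (scottContinuous_dirac_mk _)).trans
      (dirac_bind (x, y)
        (ScottHom.scottContinuous ((f ⊗ₘ g) ≫ kleisliV.unit (X' ⊗ Y')))).symm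
  leftUnitor Y := hom_ext fun p => by
    obtain ⟨x, ν⟩ : PUnit.{u + 1} × SubprobValuation Y := p
    have hg := ScottHom.scottContinuous ((λ_ Y).hom ≫ kleisliV.unit Y)
    refine (bind_bind ν (scottContinuous_dirac_mk _) hg).trans (.trans ?_ (bind_dirac ν))
    exact bind_congr rfl fun y => dirac_bind _ hg
  associator X Y W := hom_ext fun p => by
    obtain ⟨⟨x, y⟩, ν⟩ : (X × Y) × SubprobValuation W := p
    have hg := ScottHom.scottContinuous ((α_ X Y W).hom ≫ kleisliV.unit (X ⊗ Y ⊗ W))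
    refine (bind_bind ν (scottContinuous_dirac_mk _) hg).trans
      (.trans ?_ (bind_bind ν (scottContinuous_dirac_mk _) (scottContinuous_dirac_mk _)).symm)
    exact bind_congr rfl fun z => (dirac_bind _ hg).trans
      (dirac_bind _ (scottContinuous_dirac_mk _)).symm
  unit X Y := hom_ext fun p => by
    obtain ⟨x, y⟩ : X × Y := p
    exact dirac_bind _ (scottContinuous_dirac_mk _)
  mult X Y := hom_ext fun p => by
    obtain ⟨x, m⟩ : X × SubprobValuation (SubprobValuation Y) := p
    have h1 := scottContinuous_dirac_mk (E := SubprobValuation Y) x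
    have h2 : ScottContinuous fun p : X × SubprobValuation Y =>
        dirac ((strengthHom X Y).toFun p) :=
      (strengthHom X Y).scottContinuous.comp scottContinuous_dirac
    have h3 : ScottContinuous fun ν : SubprobValuation (X × Y) => ν := ScottContinuous.id
    refine (bind_bind m (ScottContinuous.id (α := SubprobValuation Y))
      (scottContinuous_dirac_mk x)).trans
      (.symm ((bind_bind (m.bind _ h1) h2 h3).trans ((bind_bind m h1 _).trans ?_)))
    exact bind_congr rfl fun ν =>
      (dirac_bind (x, ν) (scottContinuous_bind h2 (ScottContinuous.snd.comp h3) fun _ => h3)).trans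
        (dirac_bind _ h3)

/-! ### The two double strengths as iterated integrals -/

theorem scottContinuous_dirac_mk_left {D E : Type u} [PartialOrder D] [PartialOrder E] (y : E) :
    ScottContinuous fun x : D => dirac (x, y) :=
  ScottContinuous.comp (f := fun x : D => (x, y))
    (ScottContinuous.id.prodMk (ScottContinuous.const y)) scottContinuous_dirac

theorem costr_apply {D E : DCPO.{u}} (ν : SubprobValuation D) (y : E) :
    strengthV.costr D E ((ν, y) : SubprobValuation D × E) =
      ν.bind (fun x => dirac (x, y)) (scottContinuous_dirac_mk_left y) := by
  have hg := ScottHom.scottContinuous ((β_ E D).hom ≫ kleisliV.unit (D ⊗ E))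
  refine (bind_bind ν (scottContinuous_dirac_mk y) hg).trans ?_
  exact bind_congr rfl fun x => dirac_bind (y, x) hg

theorem scottContinuous_bind_dirac {D E : Type u} [PartialOrder D] [PartialOrder E]
    (μ : SubprobValuation E) :
    ScottContinuous fun x : D => μ.bind (fun y => dirac (x, y)) (scottContinuous_dirac_mk x) :=
  ScottContinuous.comp (f := fun x : D => (x, μ))
    (ScottContinuous.id.prodMk (ScottContinuous.const μ)) (strengthHom D E).scottContinuous

theorem scottContinuous_bind_dirac_left {D E : Type u} [PartialOrder D] [PartialOrder E]
    (ν : SubprobValuation D) :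
    ScottContinuous fun y : E => ν.bind (fun x => dirac (x, y)) (scottContinuous_dirac_mk_left y) :=
  scottContinuous_bind (ScottContinuous.const ν) (f := fun (y : E) (x : D) => dirac (x, y))
    (ScottContinuous.comp (f := fun q : E × D => (q.2, q.1))
      (ScottContinuous.snd.prodMk ScottContinuous.fst) scottContinuous_dirac)
    scottContinuous_dirac_mk_left

theorem costr_comp_ext_str_apply {D E : DCPO.{u}} (ν : SubprobValuation D)
    (μ : SubprobValuation E) :
    (strengthV.costr D (V E) ≫ kleisliV.ext (strengthV.str D E))
        ((ν, μ) : SubprobValuation D × SubprobValuation E) =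
      ν.bind (fun x => μ.bind (fun y => dirac (x, y)) (scottContinuous_dirac_mk x))
        (scottContinuous_bind_dirac μ) := by
  have hstr := ScottHom.scottContinuous (strengthV.str D E)
  refine (bind_congr (hf := hstr) (hg := hstr) (costr_apply (E := V E) ν μ) fun _ => rfl).trans
    ((bind_bind ν (scottContinuous_dirac_mk_left (E := V E) μ) hstr).trans ?_)
  exact bind_congr rfl fun x => dirac_bind (x, μ) hstr

theorem str_comp_ext_costr_apply {D E : DCPO.{u}} (ν : SubprobValuation D)
    (μ : SubprobValuation E) :
    (strengthV.str (V D) E ≫ kleisliV.ext (strengthV.costr D E))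
        ((ν, μ) : SubprobValuation D × SubprobValuation E) =
      μ.bind (fun y => ν.bind (fun x => dirac (x, y)) (scottContinuous_dirac_mk_left y))
        (scottContinuous_bind_dirac_left ν) := by
  have hcostr := ScottHom.scottContinuous (strengthV.costr D E)
  refine (bind_bind μ (scottContinuous_dirac_mk (D := V D) ν) hcostr).trans ?_
  exact bind_congr rfl fun y => (dirac_bind (ν, y) hcostr).trans (costr_apply ν y)

/-- Evaluated at `U`, the two sides are the iterated integrals of the indicator of `U`. Centrality
of `ν` alone is enough; `μ` is arbitrary. -/
theorem bind_bind_comm {D E : Type u} [PartialOrder D]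
    [PartialOrder E] [IsDcpo E] {ν : SubprobValuation D} (hν : ν.IsCentral)
    (μ : SubprobValuation E) :
    ν.bind (fun x => μ.bind (fun y => dirac (x, y)) (scottContinuous_dirac_mk x))
        (scottContinuous_bind_dirac μ) =
      μ.bind (fun y => ν.bind (fun x => dirac (x, y)) (scottContinuous_dirac_mk_left y))
        (scottContinuous_bind_dirac_left ν) :=
  ext_apply fun U => by
    simp only [bind_apply, dirac_apply]
    exact hν.integral_comm μ (h := U.indicator) U.scottContinuous_indicator
      fun p => ⟨U.indicator_nonneg p, U.indicator_le_one p⟩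

/-! ### The submonad of central valuations -/

theorem dirSupClosed_centralSet (D : DCPO.{u}) : DirSupClosed D.centralSet :=
  dirSupClosed_isCentral

/-- Corestriction of a morphism to a sub-dcpo. -/
def subLift {D E : DCPO.{u}} {S : Set E} (hS : DirSupClosed S) (f : D ⟶ E) (hf : ∀ x : D, f x ∈ S) :
    D ⟶ E.sub S hS :=
  (⟨fun x => ⟨f x, hf x⟩, fun d hne hd a ha => by
    have h := ScottHom.scottContinuous f hne hd ha
    refine ⟨?_, fun b hb => h.2 ?_⟩
    · rintro _ ⟨x, hx, rfl⟩
      exact h.1 ⟨x, hx, rfl⟩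
    · rintro _ ⟨x, hx, rfl⟩
      exact hb ⟨x, hx, rfl⟩⟩ : ScottHom D S)

instance (D : DCPO.{u}) (S : Set D) (hS : DirSupClosed S) : Mono (D.subIncl S hS) where
  right_cancellation _ _ h := hom_ext fun x =>
    Subtype.ext (congrArg (fun k : _ ⟶ D => k x) h)

variable (hZ : ∀ D : DCPO.{u}, DirSupClosed D.centralSet)

instance (D : DCPO.{u}) : Mono (inclZ hZ D) :=
  inferInstanceAs (Mono (D.V.subIncl D.centralSet (hZ D)))

/-- The unit of the monad of central valuations. -/
noncomputable def unitZ (D : DCPO.{u}) : D ⟶ Z hZ D :=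
  subLift (hZ D) (kleisliV.unit D) fun x => IsCentral.dirac (D := D) x

/-- The Kleisli extension of the monad of central valuations. -/
noncomputable def extZ {D E : DCPO.{u}} (f : D ⟶ Z hZ E) : Z hZ D ⟶ Z hZ E :=
  subLift (hZ E) (inclZ hZ D ≫ kleisliV.ext (f ≫ inclZ hZ E)) fun ν =>
    IsCentral.bind (ν := ν.1) ν.2 (ScottHom.scottContinuous (f ≫ inclZ hZ E)) fun x => (f x).2

/-- The Kleisli triple of central valuations. -/
noncomputable def kleisliZ : KleisliTriple (Z hZ) :=
  -- The operations are computed in `𝒱` and only corestricted, so compatibility with the inclusion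
  -- is definitional.
  kleisliV.restrict (inclZ hZ) (unitZ hZ) (extZ hZ) (fun _ => rfl) fun _ => rfl

/-- The inclusion of the monad of central valuations. -/
noncomputable def monadInclZ : (kleisliZ hZ).toMonad ⟶ kleisliV.toMonad :=
  KleisliTriple.toMonadHom (inclZ hZ) (fun _ => rfl) fun _ => rfl

instance (D : DCPO.{u}) : Mono ((monadInclZ hZ).app D) :=
  inferInstanceAs (Mono (inclZ hZ D))

/-- The strength of the monad of central valuations. -/
noncomputable def strZ (D E : DCPO.{u}) : D ⊗ Z hZ E ⟶ Z hZ (D ⊗ E) :=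
  subLift (hZ (D ⊗ E)) (D ◁ inclZ hZ E ≫ strengthV.str D E) fun p =>
    IsCentral.bind (D := E) p.2.2 (scottContinuous_dirac_mk (D := D) (E := E) p.1)
      fun _ => IsCentral.dirac _

/-- The monad of central valuations is strong. -/
noncomputable def strengthZ : MonadStrength (kleisliZ hZ).toMonad :=
  strengthV.restrict (monadInclZ hZ) (strZ hZ) fun _ _ => rfl

theorem strengthZ_isCommutative : (strengthZ hZ).IsCommutative := by
  refine MonadStrength.isCommutative_of_mono (i := monadInclZ hZ) (t := strengthV)
    (fun _ _ => rfl) fun X Y => ?_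
  refine (congrArg (fun k => _ ≫ strengthV.costr X (V Y) ≫ k)
    (kleisliV.map_comp_mu (strengthV.str X Y))).trans
    (.trans (hom_ext fun p => ?_) (congrArg (fun k => _ ≫ strengthV.str (V X) Y ≫ k)
      (kleisliV.map_comp_mu (strengthV.costr X Y))).symm)
  obtain ⟨⟨ν, hν⟩, ⟨μ, hμ⟩⟩ : Z hZ X × Z hZ Y := p
  exact (costr_comp_ext_str_apply ν μ).trans
    ((bind_bind_comm (D := X) (E := Y) hν μ).trans (str_comp_ext_costr_apply ν μ).symm)

end DCPO

open Classical in
theorem theorem2 :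
    -- the central valuations on each dcpo `D` form a sub-dcpo `𝒵 D` of `𝒱 D`,
    ∃ hZ : ∀ D : DCPO.{u}, DirSupClosed D.centralSet,
    -- and `𝒱` and `𝒵` are strong monads on `DCPO` such that
    ∃ (KV : KleisliTriple DCPO.V.{u}) (tV : MonadStrength KV.toMonad)
      (KZ : KleisliTriple (DCPO.Z hZ)) (tZ : MonadStrength KZ.toMonad),
      -- the operations of `𝒱` are the usual ones: Dirac valuations as unit,
      (∀ (D : DCPO.{u}) (x : D) (U : ScottOpens D),
        DCPO.V.eval (KV.unit D x) U = if Topology.WithScott.toScott x ∈ U then 1 else 0) ∧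
      -- integration as Kleisli extension,
      (∀ (D E : DCPO.{u}) (f : D ⟶ E.V) (ν : D.V) (U : ScottOpens E),
        (DCPO.V.eval (KV.ext f ν) U : ℝ) =
          SubprobValuation.integral ν fun x : D => (DCPO.V.eval (f x) U : ℝ)) ∧
      -- and push-forward along `y ↦ (x, y)` as strength;
      (∀ (D E : DCPO.{u}) (x : D) (ν : E.V) (U : ScottOpens (D ⊗ E : DCPO.{u})),
        DCPO.V.eval (tV.str D E (DCPO.pair x ν)) U = DCPO.V.eval ν (DCPO.slice x U)) ∧
      -- the operations of `𝒵` are the (co)restrictions of those of `𝒱`;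
      (∀ D : DCPO.{u}, KZ.unit D ≫ DCPO.inclZ hZ D = KV.unit D) ∧
      (∀ (D E : DCPO.{u}) (f : D ⟶ DCPO.Z hZ E),
        KZ.ext f ≫ DCPO.inclZ hZ E = DCPO.inclZ hZ D ≫ KV.ext (f ≫ DCPO.inclZ hZ E)) ∧
      (∀ D E : DCPO.{u},
        tZ.str D E ≫ DCPO.inclZ hZ (D ⊗ E) = D ◁ DCPO.inclZ hZ E ≫ tV.str D E) ∧
      -- and `𝒵` is commutative.
      tZ.IsCommutative := by
  refine ⟨DCPO.dirSupClosed_centralSet, DCPO.kleisliV, DCPO.strengthV, DCPO.kleisliZ _,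
    DCPO.strengthZ _, fun D x U => ?_, fun _ _ _ _ _ => rfl, fun D E x ν U => ?_, fun _ => rfl,
    fun _ _ _ => rfl, fun _ _ => rfl, DCPO.strengthZ_isCommutative _⟩
  · refine Subtype.ext ?_
    change U.indicator x = _
    unfold ScottOpens.indicator
    split_ifs <;> rfl
  -- For fixed `x`, the indicator of `U` at `(x, y)` is, as a function of `y`, the indicator of the
  -- slice.
  · exact Subtype.ext (SubprobValuation.integral_indicator (D := E) ν (DCPO.slice x U))
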